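/- For integers $m\ge 1$ and $N\ge 1$, an $m$-part sum system for $N$ is an ordered $m$-tuple $(A_1,\dots,A_m)$ of finite sets of non-negative integers, each with at least two elements, such that $\prod_{j=1}^m|A_j|=N$ and the Minkowski sum $A_1+\dots+A_m$ equals $\{0,1,\dots,N-1\}$. Let $\mathcal N_m(N)$ be the number of $m$-part sum systems for $N$, and let $\mathcal M_m(N)=\frac1{m!}\mathcal N_m(N)$. Let $d_2=1*1$ and $c_2=(1-e)*(1-e)$, where $*$ is Dirichlet convolution, $1$ is the constant function and $e(n)=\delta_{n,1}$; so $d_2(N)$ counts the ordered factorisations $N=n_1n_2$ with $n_1,n_2\ge1$, and $c_2(N)$ those with $n_1,n_2\ge 2$. Then for every integer $N\ge 2$, $$\mathcal N_2(N)=\sum_{d\mid N,\ d<N}\bigl(\mathcal N_2(d)+2\mathcal N_1(d)\bigr)=2d_2(N)-4+\sum_{d\mid N,\ d<N}\mathcal N_2(d)$$ and $$\mathcal M_2(N)=\sum_{d\mid N,\ d<N}\bigl(\mathcal M_2(d)+\mathcal M_1(d)\bigr)=c_2(N)+\sum_{d\mid N,\ d<N}\mathcal M_2(d).$$ Moreover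 $\mathcal N_1(d)=1$ for every integer $d>1$, and $c_2(N)=d_2(N)-2$. -/

import Mathlib

open scoped Pointwise

namespace SumSystem

/-- `A₁, …, A_m ⊂ ℕ₀` form an `m`-part sum system for the target set `⟨N⟩ = {0, …, N - 1}`: every
component has at least two elements, the product of the cardinalities is `N`, and the Minkowski sum
`A₁ + ⋯ + A_m` (pointwise addition of finite sets) is `⟨N⟩`. -/
structure IsSumSystem (m N : ℕ) (A : Fin m → Finset ℕ) : Prop where
  two_le_card : ∀ j, 2 ≤ (A j).card
  prod_card : ∏ j, (A j).card = N
  sum_eq : ∑ j, A j = Finset.range N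

/-- The cardinality taken in `numSumSystems` is that of a finite set. -/
theorem finite_setOf_isSumSystem (m N : ℕ) :
    {A : Fin m → Finset ℕ | IsSumSystem m N A}.Finite := by
  refine (Set.Finite.pi (t := fun _ : Fin m => (↑(Finset.range N).powerset : Set (Finset ℕ)))
    (fun _ => Finset.finite_toSet _)).subset ?_
  intro A hA j _
  simp only [Finset.coe_powerset, Set.mem_preimage, Set.mem_powerset_iff, Finset.coe_subset]
  intro a ha
  have hne : ∀ i, (A i).Nonempty := fun i =>
    Finset.card_pos.mp (lt_of_lt_of_le two_pos (hA.two_le_card i))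
  choose g hg using hne
  have hmem : ∑ i, (Function.update g j a) i ∈ ∑ i, A i := by
    rw [← Finset.mem_coe, Finset.coe_sum]
    refine Set.finsetSum_mem_finsetSum _ _ _ ?_
    intro i _
    by_cases h : i = j
    · subst h; simpa using ha
    · simpa [h] using hg i
  rw [hA.sum_eq, Finset.mem_range] at hmem
  have hle : a ≤ ∑ i, (Function.update g j a) i := by
    have := Finset.single_le_sum (f := Function.update g j a) (fun i _ => Nat.zero_le _)
      (Finset.mem_univ j)
    simpa using this
  exact Finset.mem_range.mpr (lt_of_le_of_lt hle hmem)

/-- `𝒩_m(N)`: the number of `m`-part sum systems (ordered `m`-tuples of sets) generating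
`0, …, N - 1`. -/
noncomputable def numSumSystems (m N : ℕ) : ℕ :=
  {A : Fin m → Finset ℕ | IsSumSystem m N A}.ncard

/-- `ℳ_m(N) = 𝒩_m(N) / m!`. -/
noncomputable def numSumSystemsUpToPerm (m N : ℕ) : ℚ :=
  (numSumSystems m N : ℚ) / (m.factorial : ℚ)

/-- The `j`-th divisor function `d_j = 1^{*j}`, the `j`-th Dirichlet convolution power of the
constant function `1`. -/
def divisorFun (j : ℕ) : ArithmeticFunction ℤ :=
  (ArithmeticFunction.zeta : ArithmeticFunction ℤ) ^ j

/-- The `j`-th non-trivial divisor function `c_j = (1 - e)^{*j}`, where `e`, the neutral element of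
Dirichlet convolution, is the unit `1` of the ring of arithmetic functions. -/
def nontrivialDivisorFun (j : ℕ) : ArithmeticFunction ℤ :=
  ((ArithmeticFunction.zeta : ArithmeticFunction ℤ) - 1) ^ j

end SumSystem

namespace SumSystem

open Finset

/-! A two-part sum system is a tiling of `{0, …, N - 1}` with neither part `{0}`; allowing `{0}`
makes the recursion close up. Exactly one part contains 1, so swapping reduces the count to systems
with `1 ∈ A`. Let `k` be the least positive element of `B`. By `IsTiling.block`, `A` is a union of
intervals `[jk, (j + 1)k)`, `B` consists of multiples of `k`, and `k ∣ N`. Contracting by `k` gives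
a tiling of `N / k` with 1 in the second part, and blowing up reverses this (`card_oneLeftSystems`).
These smaller tilings are swapped systems of the same kind, plus one with first part `{0}`
(`card_oneRightTilings`). Doubling gives the recursion; the rest is divisor counting. -/

/-- Every `n < N` is uniquely a sum of an element of `A` and an element of `B`, and all such sums
are less than `N`. -/
structure IsTiling (N : ℕ) (A B : Finset ℕ) : Prop where
  exists_add : ∀ n < N, ∃ a ∈ A, ∃ b ∈ B, a + b = n
  add_lt : ∀ a ∈ A, ∀ b ∈ B, a + b < N
  unique : ∀ a ∈ A, ∀ b ∈ B, ∀ a' ∈ A, ∀ b' ∈ B, a + b = a' + b' → a = a' ∧ b = b'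

/-- Once the sumset is known, the cardinality condition amounts to injectivity of addition on `A ×
B`. -/
theorem isTiling_iff {N : ℕ} {A B : Finset ℕ} :
    IsTiling N A B ↔ A + B = range N ∧ #A * #B = N := by
  constructor
  · intro h
    have hs : A + B = range N := by
      ext n
      rw [mem_add, mem_range]
      constructor
      · rintro ⟨a, ha, b, hb, rfl⟩
        exact h.add_lt a ha b hb
      · exact h.exists_add n
    refine ⟨hs, ?_⟩
    have hc : #(A + B) = #A * #B := by
      rw [card_add_iff]
      rintro ⟨a, b⟩ hab ⟨a', b'⟩ hab' heq
      simp only [Set.mem_prod, mem_coe] at hab hab'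
      have := h.unique a hab.1 b hab.2 a' hab'.1 b' hab'.2 heq
      rw [this.1, this.2]
    rw [← hc, hs, card_range]
  · rintro ⟨hs, hc⟩
    have hinj := card_add_iff.1 (show #(A + B) = #A * #B by rw [hs, card_range, hc])
    refine ⟨fun n hn => ?_, fun a ha b hb => ?_, fun a ha b hb a' ha' b' hb' heq => ?_⟩
    · rwa [← mem_range, ← hs, mem_add] at hn
    · rw [← mem_range, ← hs]
      exact add_mem_add ha hb
    · have := @hinj (a, b) ⟨ha, hb⟩ (a', b') ⟨ha', hb'⟩ heq
      simpa using this

namespace IsTiling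

variable {N k : ℕ} {A B : Finset ℕ}

theorem symm (h : IsTiling N A B) : IsTiling N B A := by
  refine ⟨fun n hn => ?_, fun a ha b hb => ?_, fun a ha b hb a' ha' b' hb' heq => ?_⟩
  · obtain ⟨a, ha, b, hb, rfl⟩ := h.exists_add n hn
    exact ⟨b, hb, a, ha, add_comm _ _⟩
  · have := h.add_lt b hb a ha
    omega
  · exact (h.unique b hb a ha b' hb' a' ha' (by omega)).symm

theorem zero_mem_left (h : IsTiling N A B) (hN : 0 < N) : 0 ∈ A := by
  obtain ⟨a, ha, b, hb, hab⟩ := h.exists_add 0 hN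
  obtain rfl : a = 0 := by omega
  exact ha

theorem zero_mem_right (h : IsTiling N A B) (hN : 0 < N) : 0 ∈ B :=
  h.symm.zero_mem_left hN

theorem lt_of_mem_left (h : IsTiling N A B) (hN : 0 < N) {a : ℕ} (ha : a ∈ A) : a < N :=
  h.add_lt a ha 0 (h.zero_mem_right hN)

theorem lt_of_mem_right (h : IsTiling N A B) (hN : 0 < N) {b : ℕ} (hb : b ∈ B) : b < N :=
  h.symm.lt_of_mem_left hN hb

theorem eq_zero_of_mem_of_mem (h : IsTiling N A B) (hN : 0 < N) {a : ℕ} (ha : a ∈ A)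
    (hb : a ∈ B) : a = 0 :=
  (h.unique a ha 0 (h.zero_mem_right hN) 0 (h.zero_mem_left hN) a hb (by omega)).1

theorem one_mem_or_one_mem (h : IsTiling N A B) (hN : 1 < N) : 1 ∈ A ∨ 1 ∈ B := by
  obtain ⟨a, ha, b, hb, hab⟩ := h.exists_add 1 hN
  rcases Nat.eq_zero_or_pos a with rfl | h0
  · right
    rwa [show 1 = b by omega]
  · left
    rwa [show 1 = a by omega]

theorem exists_pos_mem_right (h : IsTiling N A B) (hN : 0 < N) (hB : B ≠ {0}) :
    ∃ b ∈ B, 0 < b := by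
  by_contra! hcon
  refine hB (eq_singleton_iff_unique_mem.2 ⟨h.zero_mem_right hN, fun b hb => ?_⟩)
  have := hcon b hb
  omega

theorem eq_range_of_left_eq_zero (h : IsTiling N {0} B) : B = range N := by
  have := (isTiling_iff.1 h).1
  rwa [Finset.singleton_zero, zero_add] at this

theorem zero_range (N : ℕ) : IsTiling N {0} (range N) := by
  rw [isTiling_iff, Finset.singleton_zero, zero_add]
  simp

/-! ### Block structure of a tiling -/

/-- If `k` is the least positive element of `B`, then every interval `[jk, (j + 1)k)` starting
below `N` stays below `N`, lies in `A` or is disjoint from `A`, and meets `B` at most in `jk`. -/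
theorem block (h : IsTiling N A B) (hk : k ∈ B) (hk0 : 0 < k)
    (hmin : ∀ b ∈ B, 0 < b → k ≤ b) (j : ℕ) (hj : j * k < N) (r : ℕ) (hr : r < k) :
    j * k + r < N ∧ (j * k + r ∈ A ↔ j * k ∈ A) ∧ (j * k + r ∈ B → r = 0) := by
  have hN : 0 < N := by omega
  have hA0 := h.zero_mem_left hN
  have hB0 := h.zero_mem_right hN
  have hkN := h.lt_of_mem_right hN hk
  have hsmall : ∀ x < k, x ∈ A := by
    intro x hx
    obtain ⟨a, ha, b, hb, hab⟩ := h.exists_add x (by omega)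
    rcases Nat.eq_zero_or_pos b with rfl | hb0
    · rwa [show x = a by omega]
    · have := hmin b hb hb0
      omega
  induction j using Nat.strong_induction_on generalizing r with
  | _ j ih =>
  rcases Nat.eq_zero_or_pos j with rfl | hj0
  · simp only [zero_mul, zero_add]
    refine ⟨by omega, iff_of_true (hsmall r hr) hA0, fun hrB => ?_⟩
    by_contra hne
    have := hmin r hrB (by omega)
    omega
  have hjk : k ≤ j * k := Nat.le_mul_of_pos_left k hj0
  have hmulB : ∀ b ∈ B, b < j * k → ∃ i < j, b = i * k := by
    intro b hb hlt
    have hi : b / k < j := (Nat.div_lt_iff_lt_mul hk0).2 hlt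
    have hdm := Nat.div_add_mod' b k
    have := (ih (b / k) hi (by omega) (b % k) (Nat.mod_lt _ hk0)).2.2 (by rwa [hdm])
    exact ⟨b / k, hi, by omega⟩
  -- The representation `a + b` of `j * k` decides the block: `b = 0` puts it in `A`, `b > 0` keeps
  -- it out.
  obtain ⟨a, ha, b, hb, hab⟩ := h.exists_add (j * k) hj
  rcases Nat.eq_zero_or_pos b with rfl | hb0
  · obtain rfl : a = j * k := by omega
    have hlt := h.add_lt _ ha _ hk
    have hnotB : ∀ s < k, j * k + s ∉ B := by
      intro s hs hsB
      rcases Nat.eq_zero_or_pos s with rfl | hs0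
      · have := h.eq_zero_of_mem_of_mem hN ha hsB
        omega
      -- Here `jk + k` and `(k - s) + (jk + s)` would be two representations of one number.
      · have := h.unique _ ha _ hk _ (hsmall (k - s) (by omega)) _ hsB (by omega)
        omega
    refine ⟨by omega, iff_of_true ?_ ha, fun hB => absurd hB (hnotB r hr)⟩
    obtain ⟨a', ha', b', hb', hab'⟩ := h.exists_add (j * k + r) (by omega)
    rcases Nat.eq_zero_or_pos b' with rfl | hb'0
    · rwa [show j * k + r = a' by omega]
    exfalso
    rcases lt_or_ge b' (j * k) with hlt' | hge
    -- By induction `(j - i)k ∈ A`, so `jk` is both `(j - i)k + ik` and `jk + 0`.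
    · obtain ⟨i, hi, rfl⟩ := hmulB b' hb' hlt'
      have hi0 : 0 < i := Nat.pos_of_mul_pos_right hb'0
      have hsplit : (j - i) * k + i * k = j * k := by
        rw [← add_mul, Nat.sub_add_cancel hi.le]
      have hmem := (ih (j - i) (by omega) (by omega) r hr).2.1.1
        (by rwa [show (j - i) * k + r = a' by omega])
      have := h.unique _ hmem _ hb' _ ha 0 hB0 (by omega)
      omega
    · refine hnotB (b' - j * k) (by omega) ?_
      rwa [show j * k + (b' - j * k) = b' by omega]
  -- The whole block is the translate by `b` of a block of `A`, so each of its elements already has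
  -- a representation.
  · obtain ⟨i, hi, hbi, har⟩ : ∃ i, 0 < i ∧ b = i * k ∧ (∀ s < k, a + s ∈ A) := by
      rcases lt_or_ge b (j * k) with hlt | hge
      · obtain ⟨i, hi, rfl⟩ := hmulB b hb hlt
        have hi0 : 0 < i := Nat.pos_of_mul_pos_right hb0
        have hsplit : (j - i) * k + i * k = j * k := by
          rw [← add_mul, Nat.sub_add_cancel hi.le]
        obtain rfl : a = (j - i) * k := by omega
        exact ⟨i, hi0, rfl, fun s hs => (ih (j - i) (by omega) (by omega) s hs).2.1.2 ha⟩
      · obtain rfl : a = 0 := by omega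
        exact ⟨j, hj0, by omega, fun s hs => by simpa using hsmall s hs⟩
    have hnotA : ∀ s < k, j * k + s ∉ A := by
      intro s hs hsA
      have := h.unique _ (har s hs) _ hb _ hsA 0 hB0 (by omega)
      omega
    refine ⟨?_, iff_of_false (hnotA r hr) (by simpa using hnotA 0 hk0), fun hrB => ?_⟩
    · have := h.add_lt _ (har r hr) _ hb
      omega
    · have := h.unique _ (har r hr) _ hb _ hA0 _ hrB (by omega)
      omega

end IsTiling

/-! ### Blowing up and contracting tilings -/

/-- Replace each `a ∈ A` by the interval `[ka, k(a + 1))`. -/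
def blowUp (k : ℕ) (A : Finset ℕ) : Finset ℕ :=
  A.biUnion fun a => Ico (a * k) (a * k + k)

theorem mem_blowUp {k : ℕ} (hk : 0 < k) {A : Finset ℕ} {x : ℕ} :
    x ∈ blowUp k A ↔ x / k ∈ A := by
  simp only [blowUp, mem_biUnion, mem_Ico]
  constructor
  · rintro ⟨a, ha, h1, h2⟩
    rwa [Nat.div_eq_of_lt_le h1 (by rw [Nat.succ_mul]; exact h2)]
  · intro h
    have := Nat.div_add_mod' x k
    have := Nat.mod_lt x hk
    exact ⟨_, h, by omega, by omega⟩

/-- Multiply each `b ∈ B` by `k`. -/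
def dilate (k : ℕ) (B : Finset ℕ) : Finset ℕ :=
  B.image (· * k)

theorem mul_mem_dilate {k : ℕ} (hk : 0 < k) {B : Finset ℕ} {b : ℕ} :
    b * k ∈ dilate k B ↔ b ∈ B := by
  simp [dilate, hk.ne']

theorem isTiling_blowUp_dilate {k d : ℕ} {A B : Finset ℕ} (hk : 0 < k) (h : IsTiling d A B) :
    IsTiling (d * k) (blowUp k A) (dilate k B) := by
  refine ⟨fun n hn => ?_, fun a ha b hb => ?_, fun a ha b hb a' ha' b' hb' heq => ?_⟩
  · obtain ⟨a, ha, b, hb, hab⟩ := h.exists_add (n / k) ((Nat.div_lt_iff_lt_mul hk).2 hn)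
    refine ⟨a * k + n % k, ?_, b * k, (mul_mem_dilate hk).2 hb, ?_⟩
    · rw [mem_blowUp hk, mul_comm, Nat.mul_add_div hk, Nat.div_eq_of_lt (Nat.mod_lt _ hk)]
      simpa using ha
    · have := Nat.div_add_mod' n k
      rw [← hab, add_mul] at this
      omega
  · obtain ⟨b, hb', rfl⟩ := mem_image.1 hb
    have := h.add_lt _ ((mem_blowUp hk).1 ha) _ hb'
    rwa [← Nat.add_mul_div_right _ _ hk, Nat.div_lt_iff_lt_mul hk] at this
  · obtain ⟨b, hbB, rfl⟩ := mem_image.1 hb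
    obtain ⟨b', hbB', rfl⟩ := mem_image.1 hb'
    have hdiv := congrArg (· / k) heq
    simp only [Nat.add_mul_div_right _ _ hk] at hdiv
    obtain ⟨-, rfl⟩ :=
      h.unique _ ((mem_blowUp hk).1 ha) _ hbB _ ((mem_blowUp hk).1 ha') _ hbB' hdiv
    exact ⟨by omega, rfl⟩

namespace IsTiling

/-- A tiling with `1 ∈ A` and `B ≠ {0}` is the blow-up of a smaller tiling `(A', B')` with
`1 ∈ B'`. -/
theorem exists_blowUp {N : ℕ} {A B : Finset ℕ} (h : IsTiling N A B) (hN : 0 < N) (h1 : 1 ∈ A)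
    (hB : B ≠ {0}) :
    ∃ d k A' B', d * k = N ∧ 2 ≤ k ∧ IsTiling d A' B' ∧ 1 ∈ B' ∧ blowUp k A' = A ∧
      dilate k B' = B := by
  have hex := h.exists_pos_mem_right hN hB
  classical
  obtain ⟨hk, hk0⟩ := Nat.find_spec hex
  have hmin : ∀ b ∈ B, 0 < b → Nat.find hex ≤ b := fun b hb hb0 => Nat.find_min' hex ⟨hb, hb0⟩
  generalize Nat.find hex = k at hk hk0 hmin
  have hblock := h.block hk hk0 hmin
  have hk2 : 2 ≤ k := by
    by_contra hlt
    obtain rfl : k = 1 := by omega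
    exact one_ne_zero (h.eq_zero_of_mem_of_mem hN h1 hk)
  -- Otherwise the last block starts below `N` but contains `N`, contradicting `block`.
  have hdvd : N / k * k = N := by
    have hdm := Nat.div_add_mod' N k
    have hlt := Nat.mod_lt N hk0
    by_contra hne
    have := (hblock (N / k) (by omega) (N % k) hlt).1
    omega
  have hblowA : blowUp k {x ∈ range N | x * k ∈ A} = A := by
    ext x
    rw [mem_blowUp hk0, mem_filter, mem_range]
    have hdm := Nat.div_add_mod' x k
    have hlt := Nat.mod_lt x hk0
    constructor
    · rintro ⟨-, hx⟩
      have := (hblock _ (h.lt_of_mem_left hN hx) _ hlt).2.1.2 hx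
      rwa [hdm] at this
    · intro hx
      have hxN := h.lt_of_mem_left hN hx
      have hle := Nat.div_le_self x k
      refine ⟨by omega, (hblock _ (by omega) _ hlt).2.1.1 (by rwa [hdm])⟩
  have hdilB : dilate k {x ∈ range N | x * k ∈ B} = B := by
    ext x
    simp only [dilate, mem_image, mem_filter, mem_range]
    constructor
    · rintro ⟨b, ⟨-, hb⟩, rfl⟩
      exact hb
    · intro hx
      have hxN := h.lt_of_mem_right hN hx
      have hdm := Nat.div_add_mod' x k
      have hlt := Nat.mod_lt x hk0
      have hle := Nat.div_le_self x k
      have h0 := (hblock (x / k) (by omega) _ hlt).2.2 (by rwa [hdm])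
      have hxk : x / k * k = x := by omega
      exact ⟨x / k, ⟨by omega, by rwa [hxk]⟩, hxk⟩
  refine ⟨N / k, k, _, _, hdvd, hk2, ?_, ?_, hblowA, hdilB⟩
  · have hA' : ∀ x, x ∈ ({x ∈ range N | x * k ∈ A} : Finset ℕ) ↔ x * k ∈ A := by
      intro x
      conv_rhs => rw [← hblowA, mem_blowUp hk0, Nat.mul_div_cancel _ hk0]
    have hB' : ∀ x, x ∈ ({x ∈ range N | x * k ∈ B} : Finset ℕ) ↔ x * k ∈ B := by
      intro x
      conv_rhs => rw [← hdilB, mul_mem_dilate hk0]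
    refine ⟨fun n hn => ?_, fun a ha b hb => ?_, fun a ha b hb a' ha' b' hb' heq => ?_⟩
    · obtain ⟨a, ha, b, hb, hab⟩ := h.exists_add (n * k) (by
        rw [← hdvd]
        exact Nat.mul_lt_mul_of_pos_right hn hk0)
      rw [← hblowA, mem_blowUp hk0] at ha
      rw [← hdilB] at hb
      obtain ⟨b, hbB, rfl⟩ := mem_image.1 hb
      refine ⟨_, ha, b, hbB, ?_⟩
      rw [← Nat.add_mul_div_right _ _ hk0, hab, Nat.mul_div_cancel _ hk0]
    · have := h.add_lt _ ((hA' a).1 ha) _ ((hB' b).1 hb)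
      rwa [← add_mul, ← hdvd, Nat.mul_lt_mul_right hk0] at this
    · have := h.unique _ ((hA' a).1 ha) _ ((hB' b).1 hb) _ ((hA' a').1 ha') _ ((hB' b').1 hb')
        (by rw [← add_mul, ← add_mul, heq])
      exact ⟨Nat.eq_of_mul_eq_mul_right hk0 this.1, Nat.eq_of_mul_eq_mul_right hk0 this.2⟩
  · simp only [mem_filter, mem_range, one_mul]
    have := h.lt_of_mem_right hN hk
    exact ⟨by omega, hk⟩

end IsTiling

/-! ### Counting tilings by the part containing 1 -/

open Classical in
/-- The tilings `(A, B)` of `{0, …, N - 1}` with `1 ∈ B`. -/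
noncomputable def oneRightTilings (N : ℕ) : Finset (Finset ℕ × Finset ℕ) :=
  {p ∈ (range N).powerset ×ˢ (range N).powerset | IsTiling N p.1 p.2 ∧ 1 ∈ p.2}

open Classical in
/-- The two-part sum systems `(A, B)` for `N` with `1 ∈ A`. -/
noncomputable def oneLeftSystems (N : ℕ) : Finset (Finset ℕ × Finset ℕ) :=
  {p ∈ (range N).powerset ×ˢ (range N).powerset | IsTiling N p.1 p.2 ∧ 1 ∈ p.1 ∧ p.2 ≠ {0}}

theorem IsTiling.subset_range_left {N : ℕ} {A B : Finset ℕ} (h : IsTiling N A B) (hN : 0 < N) :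
    A ⊆ range N :=
  fun _ ha => mem_range.2 (h.lt_of_mem_left hN ha)

theorem mem_oneRightTilings {N : ℕ} (hN : 0 < N) {p : Finset ℕ × Finset ℕ} :
    p ∈ oneRightTilings N ↔ IsTiling N p.1 p.2 ∧ 1 ∈ p.2 := by
  simp only [oneRightTilings, mem_filter, mem_product, mem_powerset, and_iff_right_iff_imp]
  exact fun h => ⟨h.1.subset_range_left hN, h.1.symm.subset_range_left hN⟩

theorem mem_oneLeftSystems {N : ℕ} (hN : 0 < N) {p : Finset ℕ × Finset ℕ} :
    p ∈ oneLeftSystems N ↔ IsTiling N p.1 p.2 ∧ 1 ∈ p.1 ∧ p.2 ≠ {0} := by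
  simp only [oneLeftSystems, mem_filter, mem_product, mem_powerset, and_iff_right_iff_imp]
  exact fun h => ⟨h.1.subset_range_left hN, h.1.symm.subset_range_left hN⟩

/-- Swapping the parts fails to give a system only when `A = {0}`; then `B = range N`, which
contains 1 exactly when `1 < N`. -/
theorem card_oneRightTilings {N : ℕ} (hN : 0 < N) :
    #(oneRightTilings N) = #(oneLeftSystems N) + if 1 < N then 1 else 0 := by
  classical
  have hunion : oneRightTilings N = (oneLeftSystems N).map (Equiv.prodComm _ _).toEmbedding ∪
      if 1 < N then {({0}, range N)} else ∅ := by
    ext ⟨A, B⟩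
    rw [mem_union, mem_oneRightTilings hN]
    simp only [mem_map_equiv, mem_oneLeftSystems hN, Equiv.prodComm_symm, Equiv.prodComm_apply,
      Prod.swap_prod_mk]
    constructor
    · rintro ⟨h, h1⟩
      by_cases hA : A = {0}
      · subst hA
        rw [h.eq_range_of_left_eq_zero, mem_range] at h1
        right
        rw [if_pos h1, h.eq_range_of_left_eq_zero, mem_singleton]
      · exact Or.inl ⟨h.symm, h1, hA⟩
    · rintro (⟨h, h1, -⟩ | h)
      · exact ⟨h.symm, h1⟩
      · split_ifs at h with h1
        · obtain ⟨rfl, rfl⟩ := Prod.mk.inj (mem_singleton.1 h)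
          exact ⟨IsTiling.zero_range N, mem_range.2 h1⟩
        · simp at h
  rw [hunion, card_union_of_disjoint, card_map]
  · congr 1
    split_ifs <;> simp
  · split_ifs
    · simp [mem_map_equiv, mem_oneLeftSystems hN]
    · simp

theorem card_oneLeftSystems {N : ℕ} (hN : 0 < N) :
    #(oneLeftSystems N) = ∑ d ∈ N.properDivisors, #(oneRightTilings d) := by
  rw [← card_sigma]
  symm
  have hfac : ∀ d ∈ N.properDivisors, 0 < d ∧ 2 ≤ N / d ∧ d * (N / d) = N := by
    intro d hd
    obtain ⟨hdvd, hlt⟩ := Nat.mem_properDivisors.1 hd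
    have hmul := Nat.mul_div_cancel' hdvd
    refine ⟨Nat.pos_of_dvd_of_pos hdvd hN, ?_, hmul⟩
    by_contra! hcon
    have : d * (N / d) ≤ d * 1 := Nat.mul_le_mul_left d (by omega)
    omega
  refine card_bij (fun q _ => (blowUp (N / q.1) q.2.1, dilate (N / q.1) q.2.2)) ?_ ?_ ?_
  · rintro ⟨d, A, B⟩ hq
    obtain ⟨hd, hp⟩ := mem_sigma.1 hq
    obtain ⟨hd0, hk, hmul⟩ := hfac d hd
    obtain ⟨ht, h1⟩ := (mem_oneRightTilings hd0).1 hp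
    have hk0 : 0 < N / d := by omega
    rw [mem_oneLeftSystems hN]
    refine ⟨by simpa only [hmul] using isTiling_blowUp_dilate hk0 ht, ?_, fun h0 => ?_⟩
    · rw [mem_blowUp hk0, Nat.div_eq_of_lt hk]
      exact ht.zero_mem_left hd0
    · have := (mul_mem_dilate hk0).2 h1
      dsimp only at h0
      rw [h0, mem_singleton] at this
      omega
  · rintro ⟨d, A, B⟩ hq ⟨d', A', B'⟩ hq' heq
    obtain ⟨hd, hp⟩ := mem_sigma.1 hq
    obtain ⟨hd', hp'⟩ := mem_sigma.1 hq'
    obtain ⟨hd0, hk, hmul⟩ := hfac d hd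
    obtain ⟨hd0', hk', hmul'⟩ := hfac d' hd'
    dsimp only at heq
    -- The condition `1 ∈ C` makes the scale recoverable: `k` lies in the dilate by `l`, so `l ∣ k`,
    -- and symmetry gives equality.
    have hle : ∀ {k l : ℕ} {C D : Finset ℕ}, 0 < k → 1 ∈ C → dilate k C = dilate l D →
        l ≤ k := by
      intro k l C D hk hC h
      have hmem := (mul_mem_dilate hk).2 hC
      rw [h] at hmem
      obtain ⟨x, -, hx⟩ := mem_image.1 hmem
      refine Nat.le_of_dvd hk ⟨x, ?_⟩
      rw [mul_comm l x]
      omega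
    obtain ⟨hA, hB⟩ := Prod.mk.inj heq
    have hkk : N / d = N / d' :=
      le_antisymm (hle (by omega) ((mem_oneRightTilings hd0').1 hp').2 hB.symm)
        (hle (by omega) ((mem_oneRightTilings hd0).1 hp).2 hB)
    obtain rfl : d = d' :=
      Nat.eq_of_mul_eq_mul_right (show 0 < N / d by omega) (by rw [hmul, hkk, hmul'])
    have hk0 : 0 < N / d := by omega
    obtain rfl : A = A' := by
      ext x
      rw [← Nat.mul_div_cancel x hk0, ← mem_blowUp hk0, hA, mem_blowUp hk0]
    obtain rfl : B = B' := by
      ext x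
      rw [← mul_mem_dilate hk0, hB, mul_mem_dilate hk0]
    rfl
  · rintro ⟨A, B⟩ hp
    obtain ⟨ht, h1, hB⟩ := (mem_oneLeftSystems hN).1 hp
    obtain ⟨d, k, A', B', rfl, hk, ht', h1', rfl, rfl⟩ := ht.exists_blowUp hN h1 hB
    have hd0 : 0 < d := Nat.pos_of_mul_pos_right hN
    have hdk : d * k / d = k := Nat.mul_div_cancel_left k hd0
    refine ⟨⟨d, A', B'⟩, mem_sigma.2 ⟨Nat.mem_properDivisors.2 ⟨dvd_mul_right d k, ?_⟩,
      (mem_oneRightTilings hd0).2 ⟨ht', h1'⟩⟩, by simp only [hdk]⟩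
    nlinarith

theorem IsTiling.two_le_card_left_iff {N : ℕ} {A B : Finset ℕ} (h : IsTiling N A B)
    (hN : 0 < N) : 2 ≤ #A ↔ A ≠ {0} := by
  have h0 := h.zero_mem_left hN
  constructor
  · rintro h2 rfl
    simp at h2
  · intro hA
    by_contra! hlt
    refine hA (eq_singleton_iff_unique_mem.2 ⟨h0, fun a ha => ?_⟩)
    exact card_le_one.1 (by omega) a ha 0 h0

theorem isSumSystem_two_iff {N : ℕ} (hN : 0 < N) {A : Fin 2 → Finset ℕ} :
    IsSumSystem 2 N A ↔ IsTiling N (A 0) (A 1) ∧ A 0 ≠ {0} ∧ A 1 ≠ {0} := by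
  have key : IsSumSystem 2 N A ↔ IsTiling N (A 0) (A 1) ∧ 2 ≤ #(A 0) ∧ 2 ≤ #(A 1) := by
    rw [isTiling_iff]
    constructor
    · rintro ⟨h2, hp, hs⟩
      rw [Fin.prod_univ_two] at hp
      rw [Fin.sum_univ_two] at hs
      exact ⟨⟨hs, hp⟩, h2 0, h2 1⟩
    · rintro ⟨⟨hs, hp⟩, h0, h1⟩
      refine ⟨Fin.forall_fin_two.2 ⟨h0, h1⟩, ?_, ?_⟩
      · rwa [Fin.prod_univ_two]
      · rwa [Fin.sum_univ_two]
  rw [key]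
  refine and_congr_right fun h => ?_
  rw [h.two_le_card_left_iff hN, h.symm.two_le_card_left_iff hN]

theorem numSumSystems_two {N : ℕ} (hN : 0 < N) :
    numSumSystems 2 N = 2 * #(oneLeftSystems N) := by
  classical
  have himage : finTwoArrowEquiv (Finset ℕ) '' {A | IsSumSystem 2 N A} =
      ↑(oneLeftSystems N ∪ (oneLeftSystems N).map (Equiv.prodComm _ _).toEmbedding) := by
    ext ⟨A, B⟩
    rw [Equiv.image_eq_preimage_symm]
    simp only [Set.mem_preimage, Set.mem_ofPred_eq, isSumSystem_two_iff hN,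
      finTwoArrowEquiv_symm_apply, coe_union, Set.mem_union, mem_coe, mem_map_equiv,
      mem_oneLeftSystems hN, Equiv.prodComm_symm, Equiv.prodComm_apply, Prod.swap_prod_mk,
      Matrix.cons_val_zero, Matrix.cons_val_one]
    constructor
    · rintro ⟨h, hA, hB⟩
      obtain ⟨b, hb, hb0⟩ := h.exists_pos_mem_right hN hB
      have := h.lt_of_mem_right hN hb
      rcases h.one_mem_or_one_mem (by omega) with h1 | h1
      · exact Or.inl ⟨h, h1, hB⟩
      · exact Or.inr ⟨h.symm, h1, hA⟩
    · rintro (⟨h, h1, hB⟩ | ⟨h, h1, hA⟩)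
      · exact ⟨h, by rintro rfl; simp at h1, hB⟩
      · exact ⟨h.symm, hA, by rintro rfl; simp at h1⟩
  rw [numSumSystems, ← Set.ncard_image_of_injective _ (finTwoArrowEquiv (Finset ℕ)).injective,
    himage, Set.ncard_coe_finset, card_union_of_disjoint, card_map, two_mul]
  rw [disjoint_left]
  rintro ⟨A, B⟩ hp hp'
  rw [mem_map_equiv] at hp'
  obtain ⟨ht, h1, -⟩ := (mem_oneLeftSystems hN).1 hp
  obtain ⟨-, h1', -⟩ := (mem_oneLeftSystems hN).1 hp'
  exact one_ne_zero (ht.eq_zero_of_mem_of_mem hN h1 h1')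

theorem numSumSystems_one (d : ℕ) : numSumSystems 1 d = if 1 < d then 1 else 0 := by
  have hiff : ∀ A : Fin 1 → Finset ℕ, IsSumSystem 1 d A ↔ 1 < d ∧ A = fun _ => range d := by
    intro A
    constructor
    · rintro ⟨h2, hp, hs⟩
      simp only [univ_unique, prod_singleton, sum_singleton, Fin.default_eq_zero] at hp hs
      exact ⟨hp ▸ h2 0, funext fun i => by rw [Subsingleton.elim i 0, hs]⟩
    · rintro ⟨hd, rfl⟩
      exact ⟨fun _ => by rwa [card_range], by simp, by simp⟩
  simp only [numSumSystems, hiff]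
  split_ifs with h <;> simp [h]

theorem numSumSystems_two_eq_sum {N : ℕ} (hN : 0 < N) :
    numSumSystems 2 N = ∑ d ∈ N.properDivisors, (numSumSystems 2 d + 2 * numSumSystems 1 d) := by
  rw [numSumSystems_two hN, card_oneLeftSystems hN, mul_sum]
  refine sum_congr rfl fun d hd => ?_
  have hd0 := Nat.pos_of_mem_properDivisors hd
  rw [card_oneRightTilings hd0, numSumSystems_two hd0, numSumSystems_one, mul_add]

/-! ### Divisor functions -/

theorem divisorFun_two (N : ℕ) : divisorFun 2 N = #N.divisors := by
  rw [divisorFun, pow_two, ArithmeticFunction.coe_zeta_mul_apply, card_eq_sum_ones]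
  push_cast
  refine sum_congr rfl fun d hd => ?_
  simp [(Nat.pos_of_mem_divisors hd).ne']

theorem nontrivialDivisorFun_two {N : ℕ} (hN : 1 < N) :
    nontrivialDivisorFun 2 N = divisorFun 2 N - 2 := by
  have h : nontrivialDivisorFun 2 + (ArithmeticFunction.zeta : ArithmeticFunction ℤ) +
      (ArithmeticFunction.zeta : ArithmeticFunction ℤ) = divisorFun 2 + 1 := by
    rw [nontrivialDivisorFun, divisorFun]
    ring
  have hN' := congrArg (fun f : ArithmeticFunction ℤ => f N) h
  simp only [ArithmeticFunction.add_apply, ArithmeticFunction.natCoe_apply,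
    ArithmeticFunction.zeta_apply, ArithmeticFunction.one_apply_ne hN.ne',
    if_neg (show N ≠ 0 by omega)] at hN'
  push_cast at hN'
  linarith

/-- Every divisor other than 1 and `N` contributes 1 to the sum. -/
theorem sum_numSumSystems_one {N : ℕ} (hN : 1 < N) :
    ((∑ d ∈ N.properDivisors, numSumSystems 1 d : ℕ) : ℤ) = divisorFun 2 N - 2 := by
  have hmem : 1 ∈ N.properDivisors := Nat.one_mem_properDivisors_iff_one_lt.2 hN
  have hone : ∀ d ∈ N.properDivisors.erase 1, numSumSystems 1 d = 1 := by
    intro d hd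
    obtain ⟨hne, hd⟩ := mem_erase.1 hd
    have := Nat.pos_of_mem_properDivisors hd
    rw [numSumSystems_one, if_pos (by omega)]
  have hcard : #N.divisors = #N.properDivisors + 1 := by
    rw [← Nat.insert_self_properDivisors (by omega),
      card_insert_of_notMem Nat.self_notMem_properDivisors]
  have hcard' := card_erase_add_one hmem
  rw [← add_sum_erase _ _ hmem, sum_congr rfl hone, numSumSystems_one, divisorFun_two, hcard,
    ← card_eq_sum_ones]
  simp only [lt_irrefl, if_false]
  omega

end SumSystem

theorem corollary4p2 (N : ℕ) (hN : 2 ≤ N) :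
    ((SumSystem.numSumSystems 2 N : ℤ) =
        ∑ d ∈ N.properDivisors,
          ((SumSystem.numSumSystems 2 d : ℤ) + 2 * (SumSystem.numSumSystems 1 d : ℤ)) ∧
      (SumSystem.numSumSystems 2 N : ℤ) =
        2 * SumSystem.divisorFun 2 N - 4 +
          ∑ d ∈ N.properDivisors, (SumSystem.numSumSystems 2 d : ℤ)) ∧
    (SumSystem.numSumSystemsUpToPerm 2 N =
        ∑ d ∈ N.properDivisors,
          (SumSystem.numSumSystemsUpToPerm 2 d + SumSystem.numSumSystemsUpToPerm 1 d) ∧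
      SumSystem.numSumSystemsUpToPerm 2 N =
        (SumSystem.nontrivialDivisorFun 2 N : ℚ) +
          ∑ d ∈ N.properDivisors, SumSystem.numSumSystemsUpToPerm 2 d) ∧
    (∀ d : ℕ, 1 < d → SumSystem.numSumSystems 1 d = 1) ∧
    SumSystem.nontrivialDivisorFun 2 N = SumSystem.divisorFun 2 N - 2 := by
  have hsum := SumSystem.numSumSystems_two_eq_sum (show 0 < N by omega)
  have hone := SumSystem.sum_numSumSystems_one hN
  have hc := SumSystem.nontrivialDivisorFun_two hN
  have hZ : (SumSystem.numSumSystems 2 N : ℤ) = 2 * SumSystem.divisorFun 2 N - 4 +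
      ∑ d ∈ N.properDivisors, (SumSystem.numSumSystems 2 d : ℤ) := by
    rw [hsum, Finset.sum_add_distrib, ← Finset.mul_sum]
    rw [Nat.cast_add, Nat.cast_mul, hone]
    push_cast
    ring
  refine ⟨⟨?_, hZ⟩, ⟨?_, ?_⟩, fun d hd => ?_, hc⟩
  · rw [hsum]
    push_cast
    rfl
  · simp only [SumSystem.numSumSystemsUpToPerm]
    rw [hsum]
    push_cast
    rw [Finset.sum_div]
    refine Finset.sum_congr rfl fun d _ => ?_
    norm_num [Nat.factorial]
    ring
  · have hQ : (SumSystem.numSumSystems 2 N : ℚ) = 2 * (SumSystem.divisorFun 2 N : ℚ) - 4 +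
        ∑ d ∈ N.properDivisors, (SumSystem.numSumSystems 2 d : ℚ) := by
      exact_mod_cast hZ
    simp only [SumSystem.numSumSystemsUpToPerm]
    rw [hc, hQ, ← Finset.sum_div]
    push_cast [Nat.factorial]
    ring
  · rw [SumSystem.numSumSystems_one, if_pos hd]
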